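/- Fix a propositional language that contains the binary connectives $\wedge,\vee,\to,*$ and the constants $\top,\bot,1,0$, and possibly further connectives of finite arity, and fix a set of atoms. A (single-conclusion) sequent is an expression $\Gamma\Rightarrow\Delta$, where $\Gamma$ is a finite multiset of formulas and $\Delta$ is empty or a single formula. The calculus $\mathbf{FL_e}$ has the axioms $$\phi\Rightarrow\phi,\qquad \Gamma\Rightarrow\top,\qquad \Gamma,\bot\Rightarrow\Delta,\qquad \Rightarrow 1,\qquad 0\Rightarrow$$ and the rules (premises $/$ conclusion) $$\Gamma\Rightarrow\Delta\;/\;\Gamma,1\Rightarrow\Delta\qquad \Gamma\Rightarrow\;/\;\Gamma\Rightarrow 0$$ $$\Gamma,\phi\Rightarrow\Delta\;/\;\Gamma,\phi\wedge\psi\Rightarrow\Delta\qquad \Gamma,\psi\Rightarrow\Delta\;/\;\Gamma,\phi\wedge\psi\Rightarrow\Delta\qquad \Gamma\Rightarrow\phi\;;\;\Gamma\Rightarrow\psi\;/\;\Gamma\Rightarrow\phi\wedge\psi$$ $$\Gamma,\phi\Rightarrow\Delta\;;\;\Gamma,\psi\Rightarrow\Delta\;/\;\Gamma,\phi\vee\psi\Rightarrow\Delta\qquad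 \Gamma\Rightarrow\phi\;/\;\Gamma\Rightarrow\phi\vee\psi\qquad \Gamma\Rightarrow\psi\;/\;\Gamma\Rightarrow\phi\vee\psi$$ $$\Gamma,\phi,\psi\Rightarrow\Delta\;/\;\Gamma,\phi*\psi\Rightarrow\Delta\qquad \Gamma\Rightarrow\phi\;;\;\Sigma\Rightarrow\psi\;/\;\Gamma,\Sigma\Rightarrow\phi*\psi$$ $$\Gamma\Rightarrow\phi\;;\;\Sigma,\psi\Rightarrow\Delta\;/\;\Gamma,\Sigma,\phi\to\psi\Rightarrow\Delta\qquad \Gamma,\phi\Rightarrow\psi\;/\;\Gamma\Rightarrow\phi\to\psi.$$ The calculus $\mathbf{FL_{ew}}$ adds to it the weakening rules $\Gamma\Rightarrow\Delta\;/\;\Gamma,\phi\Rightarrow\Delta$ and $\Gamma\Rightarrow\;/\;\Gamma\Rightarrow\phi$. If the language has a unary connective $\Box$, then the $\mathbf{K}$-version of a calculus adds the rule $(K)$: $\Gamma\Rightarrow\phi\;/\;\Box\Gamma\Rightarrow\Box\phi$, and the $\mathbf{KD}$-version adds both $(K)$ and the rule $(D)$: $\Gamma\Rightarrow\;/\;\Box\Gamma\Rightarrow$,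 where $\Box\Gamma$ is the multiset of all $\Box\gamma$ with $\gamma$ in $\Gamma$, and $\Gamma$ may be empty. Further connectives have no rules of their own. The logic $L$ of a calculus is given by: $L\vdash\phi$ if and only if the sequent $\Rightarrow\phi$ has a proof (a finite tree of rule instances) in the calculus. A formula is $p$-free if the atom $p$ does not occur in it. A logic $L$ has the uniform interpolation property if for every formula $\phi$ and every atom $p$ there are $p$-free formulas $\forall p\,\phi$ and $\exists p\,\phi$ such that (i) $L\vdash\forall p\,\phi\to\phi$; (ii) for every $p$-free formula $\psi$, if $L\vdash\psi\to\phi$ then $L\vdash\psi\to\forall p\,\phi$; (iii) $L\vdash\phi\to\exists p\,\phi$; (iv) for every $p$-free formula $\psi$, if $L\vdash\phi\to\psi$ then $L\vdash\exists p\,\phi\to\psi$. **Corollary.** The logics $\mathbf{FL_e}$ and $\mathbf{FL_{ew}}$ have the uniform interpolation property and, if the language has a unary connective $\Box$, so do the $\mathbf{K}$-version and the $\mathbf{KD}$-version of each of them. -/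

import Mathlib

namespace Substructural

/-- A propositional language, given by its connectives other than `∧, ∨, →, *, ⊤, ⊥, 1, 0`,
which are always present. The case `Conn = Empty` is the bare language. -/
structure Language where
  Conn : Type*
  arity : Conn → ℕ

/-- Formulas of the language `L` over the set `α` of atoms. -/
inductive Formula (L : Language) (α : Type*) where
  | atom (p : α)
  | top
  | bot
  | one
  | zero
  | and (φ ψ : Formula L α)
  | or (φ ψ : Formula L α)
  | fus (φ ψ : Formula L α)
  | imp (φ ψ : Formula L α)
  | app (c : L.Conn) (args : Fin (L.arity c) → Formula L α)

/-- The set of atoms occurring in a formula. -/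
def Formula.vars {L : Language} {α : Type*} : Formula L α → Set α
  | .atom p => {p}
  | .top => ∅
  | .bot => ∅
  | .one => ∅
  | .zero => ∅
  | .and φ ψ => φ.vars ∪ ψ.vars
  | .or φ ψ => φ.vars ∪ ψ.vars
  | .fus φ ψ => φ.vars ∪ ψ.vars
  | .imp φ ψ => φ.vars ∪ ψ.vars
  | .app _ args => ⋃ i, (args i).vars

/-- `φ` is `p`-free. -/
def Formula.Free {L : Language} {α : Type*} (p : α) (φ : Formula L α) : Prop :=
  p ∉ φ.vars

/-- The formula `□ φ`, where `b` is the connective playing the role of `□`.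
It is used only for connectives `b` of arity one. -/
def Formula.box {L : Language} {α : Type*} (b : L.Conn) (φ : Formula L α) : Formula L α :=
  .app b (fun _ => φ)

/-- Single-conclusion sequents `Γ ⇒ Δ`: `Γ` is a finite multiset of formulas and `Δ` is either
empty (`none`) or a single formula (`some φ`). -/
structure Sequent (L : Language) (α : Type*) where
  ant : Multiset (Formula L α)
  suc : Option (Formula L α)

/-- A sequent calculus, as the set of instances of its rules: `R ps S` says that the list of
premises `ps` and the conclusion `S` form such an instance. Axioms have no premises. -/
abbrev Calculus (L : Language) (α : Type*) := List (Sequent L α) → Sequent L α → Prop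

/-- Derivability by finite proof trees. -/
inductive Derivable {L : Language} {α : Type*} (R : Calculus L α) : Sequent L α → Prop where
  | step (ps : List (Sequent L α)) (S : Sequent L α) (h : R ps S)
      (hps : ∀ T ∈ ps, Derivable R T) : Derivable R S

section Rules

variable {L : Language} {α : Type*}

/-- The axioms and rules of `FL_e`. -/
inductive FLe : Calculus L α where
  | identity (φ : Formula L α) : FLe [] ⟨{φ}, some φ⟩
  | top_right (Γ : Multiset (Formula L α)) : FLe [] ⟨Γ, some .top⟩
  | bot_left (Γ : Multiset (Formula L α)) (Δ : Option (Formula L α)) :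
      FLe [] ⟨.bot ::ₘ Γ, Δ⟩
  | one_right : FLe [] ⟨0, some .one⟩
  | zero_left : FLe [] ⟨{.zero}, none⟩
  | one_left (Γ : Multiset (Formula L α)) (Δ : Option (Formula L α)) :
      FLe [⟨Γ, Δ⟩] ⟨.one ::ₘ Γ, Δ⟩
  | zero_right (Γ : Multiset (Formula L α)) :
      FLe [⟨Γ, none⟩] ⟨Γ, some .zero⟩
  | and_left₁ (Γ : Multiset (Formula L α)) (φ ψ : Formula L α) (Δ : Option (Formula L α)) :
      FLe [⟨φ ::ₘ Γ, Δ⟩] ⟨.and φ ψ ::ₘ Γ, Δ⟩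
  | and_left₂ (Γ : Multiset (Formula L α)) (φ ψ : Formula L α) (Δ : Option (Formula L α)) :
      FLe [⟨ψ ::ₘ Γ, Δ⟩] ⟨.and φ ψ ::ₘ Γ, Δ⟩
  | and_right (Γ : Multiset (Formula L α)) (φ ψ : Formula L α) :
      FLe [⟨Γ, some φ⟩, ⟨Γ, some ψ⟩] ⟨Γ, some (.and φ ψ)⟩
  | or_left (Γ : Multiset (Formula L α)) (φ ψ : Formula L α) (Δ : Option (Formula L α)) :
      FLe [⟨φ ::ₘ Γ, Δ⟩, ⟨ψ ::ₘ Γ, Δ⟩] ⟨.or φ ψ ::ₘ Γ, Δ⟩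
  | or_right₁ (Γ : Multiset (Formula L α)) (φ ψ : Formula L α) :
      FLe [⟨Γ, some φ⟩] ⟨Γ, some (.or φ ψ)⟩
  | or_right₂ (Γ : Multiset (Formula L α)) (φ ψ : Formula L α) :
      FLe [⟨Γ, some ψ⟩] ⟨Γ, some (.or φ ψ)⟩
  | fus_left (Γ : Multiset (Formula L α)) (φ ψ : Formula L α) (Δ : Option (Formula L α)) :
      FLe [⟨φ ::ₘ ψ ::ₘ Γ, Δ⟩] ⟨.fus φ ψ ::ₘ Γ, Δ⟩
  | fus_right (Γ Θ : Multiset (Formula L α)) (φ ψ : Formula L α) :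
      FLe [⟨Γ, some φ⟩, ⟨Θ, some ψ⟩] ⟨Γ + Θ, some (.fus φ ψ)⟩
  | imp_left (Γ Θ : Multiset (Formula L α)) (φ ψ : Formula L α) (Δ : Option (Formula L α)) :
      FLe [⟨Γ, some φ⟩, ⟨ψ ::ₘ Θ, Δ⟩] ⟨.imp φ ψ ::ₘ (Γ + Θ), Δ⟩
  | imp_right (Γ : Multiset (Formula L α)) (φ ψ : Formula L α) :
      FLe [⟨φ ::ₘ Γ, some ψ⟩] ⟨Γ, some (.imp φ ψ)⟩

/-- The left and right weakening rules. -/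
inductive Weakening : Calculus L α where
  | left (Γ : Multiset (Formula L α)) (φ : Formula L α) (Δ : Option (Formula L α)) :
      Weakening [⟨Γ, Δ⟩] ⟨φ ::ₘ Γ, Δ⟩
  | right (Γ : Multiset (Formula L α)) (φ : Formula L α) :
      Weakening [⟨Γ, none⟩] ⟨Γ, some φ⟩

/-- The modal rule `K`: from `Γ ⇒ φ` infer `□Γ ⇒ □φ`. -/
inductive RuleK (b : L.Conn) : Calculus L α where
  | intro (Γ : Multiset (Formula L α)) (φ : Formula L α) :
      RuleK b [⟨Γ, some φ⟩] ⟨Γ.map (Formula.box b), some (φ.box b)⟩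

/-- The modal rule `D`: from `Γ ⇒` infer `□Γ ⇒`. -/
inductive RuleD (b : L.Conn) : Calculus L α where
  | intro (Γ : Multiset (Formula L α)) :
      RuleD b [⟨Γ, none⟩] ⟨Γ.map (Formula.box b), none⟩

/-- `FL_ew`: `FL_e` with the weakening rules. -/
def FLew : Calculus L α := fun ps S => FLe ps S ∨ Weakening ps S

/-- The `K`-version of a calculus. -/
def Calculus.withK (R : Calculus L α) (b : L.Conn) : Calculus L α :=
  fun ps S => R ps S ∨ RuleK b ps S

/-- The `KD`-version of a calculus. -/
def Calculus.withKD (R : Calculus L α) (b : L.Conn) : Calculus L α :=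
  fun ps S => R ps S ∨ RuleK b ps S ∨ RuleD b ps S

/-- The logic of a calculus: the set of formulas `φ` such that `⇒ φ` is derivable. -/
def Calculus.logic (R : Calculus L α) : Set (Formula L α) :=
  {φ | Derivable R ⟨0, some φ⟩}

/-- The uniform interpolation property of a logic, given as its set of theorems. In it, `A` is the
`p`-pre-interpolant `∀p φ` and `E` is the `p`-post-interpolant `∃p φ`. -/
def HasUniformInterpolation (T : Set (Formula L α)) : Prop :=
  ∀ (φ : Formula L α) (p : α), ∃ A E : Formula L α, A.Free p ∧ E.Free p ∧
    (Formula.imp A φ) ∈ T ∧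
    (∀ ψ : Formula L α, ψ.Free p → Formula.imp ψ φ ∈ T → Formula.imp ψ A ∈ T) ∧
    (Formula.imp φ E) ∈ T ∧
    (∀ ψ : Formula L α, ψ.Free p → Formula.imp φ ψ ∈ T → Formula.imp E ψ ∈ T)

end Rules

end Substructural

namespace Substructural

universe u v

variable {L : Language.{u}} {α : Type v}

/-! ### Splitting multisets -/

/-! The calculi have neither cut nor contraction, so, read upwards, their rules lower the weight of
a sequent; the one exception is the rule `D` with empty antecedent. Interpolants can therefore be
built by recursion on weight, as in Pitts's method. The recursion needs a form for sequents: `IsPre`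
asks for the weakest `p`-free assumption under which `Γ ⇒ Δ` holds, and `IsPost` for the strongest
`p`-free consequence of `Γ`, both tested against arbitrary `p`-free contexts `Ξ`. The theorem is the
case of `⇒ φ` and of the multiset `{φ}`.

No explicit interpolant is written down for each rule. A finite set of candidates is formed from the
subformulas, the constants and the interpolants of smaller sequents (`Candidate`). The
pre-interpolant is the disjunction of all `p`-free candidates `s` with `s, Γ ⇒ Δ` provable
(`exists_join`); the post-interpolant is the conjunction of all `p`-free candidates `s` with `Γ ⇒ s`
provable (`exists_meet`). Soundness is then automatic. Optimality (`exists_isPre`, `exists_isPost`)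
is by induction on a proof of `Ξ, Γ ⇒ Δ`. If the last rule acts on the `p`-free part and leaves `Γ`
in one piece, the induction hypothesis is followed by the same rule. If it acts on the interpolated
part or splits `Γ`, the interpolants of the pieces combine to a candidate. Cut is never used.

The six logics are treated at once through `Prf`, with parameters for weakening, the boxes and `D`.
-/

theorem cons_eq_add_cases {β : Type*} {a : β} {Γ Ξ Θ : Multiset β} (h : a ::ₘ Γ = Ξ + Θ) :
    (∃ Ξ', Ξ = a ::ₘ Ξ' ∧ Γ = Ξ' + Θ) ∨ ∃ Θ', Θ = a ::ₘ Θ' ∧ Γ = Ξ + Θ' := by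
  have ha : a ∈ Ξ + Θ := h ▸ Multiset.mem_cons_self a Γ
  rcases Multiset.mem_add.1 ha with ha | ha
  · obtain ⟨Ξ', rfl⟩ := Multiset.exists_cons_of_mem ha
    rw [Multiset.cons_add, Multiset.cons_inj_right] at h
    exact .inl ⟨Ξ', rfl, h⟩
  · obtain ⟨Θ', rfl⟩ := Multiset.exists_cons_of_mem ha
    rw [Multiset.add_cons, Multiset.cons_inj_right] at h
    exact .inr ⟨Θ', rfl, h⟩

/-- Riesz refinement for multisets: when a rule splits `Ξ + Γ` between two premises, it splits `Ξ`
and `Γ` separately. -/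
theorem add_eq_add_refine {β : Type*} {Γ Δ Ξ Θ : Multiset β} (h : Γ + Δ = Ξ + Θ) :
    ∃ Ξ₁ Ξ₂ Θ₁ Θ₂, Γ = Ξ₁ + Θ₁ ∧ Δ = Ξ₂ + Θ₂ ∧ Ξ = Ξ₁ + Ξ₂ ∧ Θ = Θ₁ + Θ₂ := by
  induction Γ using Multiset.induction generalizing Ξ Θ with
  | empty => exact ⟨0, Ξ, 0, Θ, by simp, by simpa using h, by simp, by simp⟩
  | cons a Γ ih =>
    rw [Multiset.cons_add] at h
    rcases cons_eq_add_cases h with ⟨Ξ', rfl, h'⟩ | ⟨Θ', rfl, h'⟩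
    · obtain ⟨Ξ₁, Ξ₂, Θ₁, Θ₂, rfl, rfl, rfl, rfl⟩ := ih h'
      exact ⟨a ::ₘ Ξ₁, Ξ₂, Θ₁, Θ₂, by simp, rfl, by simp, rfl⟩
    · obtain ⟨Ξ₁, Ξ₂, Θ₁, Θ₂, rfl, rfl, rfl, rfl⟩ := ih h'
      exact ⟨Ξ₁, Ξ₂, a ::ₘ Θ₁, Θ₂, by simp, rfl, rfl, by simp⟩

theorem map_eq_add_refine {β γ : Type*} {f : β → γ} {Γ : Multiset β} {Ξ Θ : Multiset γ}
    (h : Γ.map f = Ξ + Θ) :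
    ∃ Ξ' Θ', Γ = Ξ' + Θ' ∧ Ξ = Ξ'.map f ∧ Θ = Θ'.map f := by
  induction Γ using Multiset.induction generalizing Ξ Θ with
  | empty =>
    obtain ⟨rfl, rfl⟩ : Ξ = 0 ∧ Θ = 0 := by simpa [eq_comm] using h
    exact ⟨0, 0, by simp⟩
  | cons a Γ ih =>
    rw [Multiset.map_cons] at h
    rcases cons_eq_add_cases h with ⟨Ξ', rfl, h'⟩ | ⟨Θ', rfl, h'⟩
    · obtain ⟨Ξ₁, Θ₁, rfl, rfl, rfl⟩ := ih h'
      exact ⟨a ::ₘ Ξ₁, Θ₁, by simp⟩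
    · obtain ⟨Ξ₁, Θ₁, rfl, rfl, rfl⟩ := ih h'
      exact ⟨Ξ₁, a ::ₘ Θ₁, by simp⟩

/-- Every element occurs at most `n` times, so such a multiset lies below `n` copies of `F`. -/
theorem finite_multisets_over {β : Type*} {F : Set β} (hF : F.Finite) (n : ℕ) :
    {Γ : Multiset β | (∀ γ ∈ Γ, γ ∈ F) ∧ Γ.card ≤ n}.Finite := by
  classical
  refine (Set.finite_Iic (n • hF.toFinset.val)).subset fun Γ ⟨h, hn⟩ => ?_
  refine Multiset.le_iff_count.2 fun a => ?_
  by_cases ha : a ∈ Γ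
  · rw [Multiset.count_nsmul,
      Multiset.count_eq_one_of_mem hF.toFinset.nodup ((hF.mem_toFinset).2 (h a ha)), mul_one]
    exact (Multiset.count_le_card a Γ).trans hn
  · simp [Multiset.count_eq_zero_of_notMem ha]

/-! ### A presentation of the calculi without lists of premises -/

/-- The left rules with one premise, which replace the principal formula by a multiset. -/
inductive LeftRule (W : Prop) : Formula L α → Multiset (Formula L α) → Prop
  | one : LeftRule W .one 0
  | and₁ (φ ψ : Formula L α) : LeftRule W (.and φ ψ) {φ}
  | and₂ (φ ψ : Formula L α) : LeftRule W (.and φ ψ) {ψ}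
  | fus (φ ψ : Formula L α) : LeftRule W (.fus φ ψ) {φ, ψ}
  | weakening (hW : W) (φ : Formula L α) : LeftRule W φ 0

/-- The right rules with one premise that leave the antecedent unchanged; the succedent of the
premise comes first. -/
inductive RightRule (W : Prop) : Option (Formula L α) → Option (Formula L α) → Prop
  | zero : RightRule W none (some .zero)
  | or₁ (φ ψ : Formula L α) : RightRule W (some φ) (some (.or φ ψ))
  | or₂ (φ ψ : Formula L α) : RightRule W (some ψ) (some (.or φ ψ))
  | weakening (hW : W) (φ : Formula L α) : RightRule W none (some φ)

/-- Provability in `FL_e`, with weakening if `W` holds, with the rule `K` for the connectives in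
`K` and, if `D` holds, the rule `D` for them. -/
inductive Prf (W : Prop) (K : Set L.Conn) (D : Prop) :
    Multiset (Formula L α) → Option (Formula L α) → Prop
  | id (φ : Formula L α) : Prf W K D {φ} (some φ)
  | top (Γ : Multiset (Formula L α)) : Prf W K D Γ (some .top)
  | bot (Γ : Multiset (Formula L α)) (Δ : Option (Formula L α)) : Prf W K D (.bot ::ₘ Γ) Δ
  | one : Prf W K D 0 (some .one)
  | zero : Prf W K D {.zero} none
  | left {a : Formula L α} {N Γ : Multiset (Formula L α)} {Δ : Option (Formula L α)}
      (r : LeftRule W a N) (h : Prf W K D (N + Γ) Δ) : Prf W K D (a ::ₘ Γ) Δ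
  | right {Γ : Multiset (Formula L α)} {Δ' Δ : Option (Formula L α)}
      (r : RightRule W Δ' Δ) (h : Prf W K D Γ Δ') : Prf W K D Γ Δ
  | orL {Γ : Multiset (Formula L α)} {φ ψ : Formula L α} {Δ : Option (Formula L α)}
      (h₁ : Prf W K D (φ ::ₘ Γ) Δ) (h₂ : Prf W K D (ψ ::ₘ Γ) Δ) : Prf W K D (.or φ ψ ::ₘ Γ) Δ
  | impL {Γ Θ : Multiset (Formula L α)} {φ ψ : Formula L α} {Δ : Option (Formula L α)}
      (h₁ : Prf W K D Γ (some φ)) (h₂ : Prf W K D (ψ ::ₘ Θ) Δ) :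
      Prf W K D (.imp φ ψ ::ₘ (Γ + Θ)) Δ
  | andR {Γ : Multiset (Formula L α)} {φ ψ : Formula L α}
      (h₁ : Prf W K D Γ (some φ)) (h₂ : Prf W K D Γ (some ψ)) : Prf W K D Γ (some (.and φ ψ))
  | fusR {Γ Θ : Multiset (Formula L α)} {φ ψ : Formula L α}
      (h₁ : Prf W K D Γ (some φ)) (h₂ : Prf W K D Θ (some ψ)) :
      Prf W K D (Γ + Θ) (some (.fus φ ψ))
  | impR {Γ : Multiset (Formula L α)} {φ ψ : Formula L α}
      (h : Prf W K D (φ ::ₘ Γ) (some ψ)) : Prf W K D Γ (some (.imp φ ψ))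
  | modal {Γ : Multiset (Formula L α)} {Δ : Option (Formula L α)} {b : L.Conn} (hb : b ∈ K)
      (hD : Δ = none → D) (h : Prf W K D Γ Δ) :
      Prf W K D (Γ.map (Formula.box b)) (Δ.map (Formula.box b))

/-- `R` consists of the rules of `FL_e`, those of weakening if `W` holds, the rule `K` for the
connectives in `K` and, if `D` holds, the rule `D` for them. -/
def Calculus.HasRules (R : Calculus L α) (W : Prop) (K : Set L.Conn) (D : Prop) : Prop :=
  ∀ ps S, R ps S ↔ FLe ps S ∨ (W ∧ Weakening ps S) ∨ (∃ b ∈ K, RuleK b ps S) ∨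
    (D ∧ ∃ b ∈ K, RuleD b ps S)

section Prf

variable {R : Calculus L α} {W : Prop} {K : Set L.Conn} {D : Prop}

theorem Derivable.prf (hR : R.HasRules W K D) {S : Sequent L α} (h : Derivable R S) :
    Prf W K D S.ant S.suc := by
  induction h with
  | step ps S h _ ih =>
    rcases (hR ps S).1 h with h | ⟨hW, h⟩ | ⟨b, hb, h⟩ | ⟨hD, b, hb, h⟩
    · cases h with
      | identity φ => exact .id φ
      | top_right Γ => exact .top Γ
      | bot_left Γ Δ => exact .bot Γ Δ
      | one_right => exact .one
      | zero_left => exact .zero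
      | one_left Γ Δ => exact .left .one (by simpa using ih)
      | zero_right Γ => exact .right .zero (by simpa using ih)
      | and_left₁ Γ φ ψ Δ => exact .left (.and₁ φ ψ) (by simpa using ih)
      | and_left₂ Γ φ ψ Δ => exact .left (.and₂ φ ψ) (by simpa using ih)
      | and_right Γ φ ψ => exact .andR (by simp_all) (by simp_all)
      | or_left Γ φ ψ Δ => exact .orL (by simp_all) (by simp_all)
      | or_right₁ Γ φ ψ => exact .right (.or₁ φ ψ) (by simpa using ih)
      | or_right₂ Γ φ ψ => exact .right (.or₂ φ ψ) (by simpa using ih)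
      | fus_left Γ φ ψ Δ => exact .left (.fus φ ψ) (by simpa using ih)
      | fus_right Γ Θ φ ψ => exact .fusR (by simp_all) (by simp_all)
      | imp_left Γ Θ φ ψ Δ => exact .impL (by simp_all) (by simp_all)
      | imp_right Γ φ ψ => exact .impR (by simpa using ih)
    · cases h with
      | left Γ φ Δ => exact .left (.weakening hW φ) (by simpa using ih)
      | right Γ φ => exact .right (.weakening hW φ) (by simpa using ih)
    · cases h with
      | intro Γ φ => exact .modal (Δ := some φ) hb (by simp) (by simpa using ih)
    · cases h with
      | intro Γ => exact .modal (Δ := none) hb (fun _ => hD) (by simpa using ih)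

theorem Prf.derivable (hR : R.HasRules W K D) {Γ : Multiset (Formula L α)}
    {Δ : Option (Formula L α)} (h : Prf W K D Γ Δ) : Derivable R ⟨Γ, Δ⟩ := by
  have fle {ps S} (h : FLe ps S) (hps : ∀ T ∈ ps, Derivable R T) : Derivable R S :=
    .step ps S ((hR ps S).2 (.inl h)) hps
  have weak {ps S} (hW : W) (h : Weakening ps S) (hps : ∀ T ∈ ps, Derivable R T) :
      Derivable R S := .step ps S ((hR ps S).2 (.inr (.inl ⟨hW, h⟩))) hps
  induction h with
  | id φ => exact fle (.identity φ) (by simp)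
  | top Γ => exact fle (.top_right Γ) (by simp)
  | bot Γ Δ => exact fle (.bot_left Γ Δ) (by simp)
  | one => exact fle .one_right (by simp)
  | zero => exact fle .zero_left (by simp)
  | left r _ ih =>
    cases r with
    | one => exact fle (.one_left _ _) (by simpa using ih)
    | and₁ φ ψ => exact fle (.and_left₁ _ φ ψ _) (by simpa using ih)
    | and₂ φ ψ => exact fle (.and_left₂ _ φ ψ _) (by simpa using ih)
    | fus φ ψ => exact fle (.fus_left _ φ ψ _) (by simpa using ih)
    | weakening hW => exact weak hW (.left _ _ _) (by simpa using ih)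
  | right r _ ih =>
    cases r with
    | zero => exact fle (.zero_right _) (by simpa using ih)
    | or₁ φ ψ => exact fle (.or_right₁ _ φ ψ) (by simpa using ih)
    | or₂ φ ψ => exact fle (.or_right₂ _ φ ψ) (by simpa using ih)
    | weakening hW φ => exact weak hW (.right _ φ) (by simpa using ih)
  | orL _ _ ih₁ ih₂ => exact fle (.or_left _ _ _ _) (by simp [ih₁, ih₂])
  | impL _ _ ih₁ ih₂ => exact fle (.imp_left _ _ _ _ _) (by simp [ih₁, ih₂])
  | andR _ _ ih₁ ih₂ => exact fle (.and_right _ _ _) (by simp [ih₁, ih₂])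
  | fusR _ _ ih₁ ih₂ => exact fle (.fus_right _ _ _ _) (by simp [ih₁, ih₂])
  | impR _ ih => exact fle (.imp_right _ _ _) (by simpa using ih)
  | @modal Γ Δ b hb hD _ ih =>
    cases Δ with
    | none =>
      exact .step [⟨Γ, none⟩] ⟨Γ.map (Formula.box b), none⟩
        ((hR _ _).2 (.inr (.inr (.inr ⟨hD rfl, b, hb, .intro Γ⟩)))) (by simpa using ih)
    | some φ =>
      exact .step [⟨Γ, some φ⟩] ⟨Γ.map (Formula.box b), some (φ.box b)⟩
        ((hR _ _).2 (.inr (.inr (.inl ⟨b, hb, .intro Γ φ⟩)))) (by simpa using ih)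

theorem Prf.left_add {a : Formula L α} {N Γ : Multiset (Formula L α)} {s : Formula L α}
    {Δ : Option (Formula L α)} (r : LeftRule W a N) (h : Prf W K D (s ::ₘ (N + Γ)) Δ) :
    Prf W K D (s ::ₘ a ::ₘ Γ) Δ := by
  rw [Multiset.cons_swap]
  exact .left r (by rwa [Multiset.add_cons])

/-- Inversion without cut: over an empty antecedent, an implication can only come from its right
rule or from right weakening. -/
theorem Prf.imp_inv {φ ψ : Formula L α} (h : Prf W K D 0 (some (.imp φ ψ))) :
    Prf W K D {φ} (some ψ) := by
  generalize hΓ : (0 : Multiset (Formula L α)) = Γ at h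
  generalize hΔ : some (Formula.imp φ ψ) = Δ at h
  cases h with
  | right r h =>
    cases r with
    | weakening hW χ =>
      subst hΓ
      -- Here the empty sequent is provable, and weakening on both sides gives `φ ⇒ ψ`.
      exact .left (Γ := 0) (.weakening hW φ) (by simpa using Prf.right (.weakening hW ψ) h)
    | _ => simp at hΔ
  | impR h =>
    obtain ⟨rfl, rfl⟩ : φ = _ ∧ ψ = _ := by simpa using hΔ
    subst hΓ
    exact h
  | @modal Γ Δ =>
    cases Δ with
    | none => simp at hΔ
    | some χ => simp [Formula.box] at hΔ
  | _ => simp at hΓ hΔ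

theorem prf_imp_iff {φ ψ : Formula L α} :
    Prf W K D 0 (some (.imp φ ψ)) ↔ Prf W K D {φ} (some ψ) :=
  ⟨Prf.imp_inv, fun h => .impR (by simpa using h)⟩

end Prf

/-! ### Weights, subformulas, free formulas -/

namespace Formula

/-- The number of symbols of a formula, with two for an implication. -/
def weight : Formula L α → ℕ
  | .atom _ => 1
  | .top => 1
  | .bot => 1
  | .one => 1
  | .zero => 1
  | .and φ ψ => φ.weight + ψ.weight + 1
  | .or φ ψ => φ.weight + ψ.weight + 1
  | .fus φ ψ => φ.weight + ψ.weight + 1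
  | .imp φ ψ => φ.weight + ψ.weight + 2
  | .app _ args => ∑ i, (args i).weight + 1

theorem weight_pos (φ : Formula L α) : 0 < φ.weight := by
  cases φ <;> simp [weight]

theorem weight_box {b : L.Conn} (hb : L.arity b = 1) (φ : Formula L α) :
    (φ.box b).weight = φ.weight + 1 := by
  simp [box, weight, hb]

/-- The immediate subformulas of a formula. -/
def children : Formula L α → Set (Formula L α)
  | .and φ ψ => {φ, ψ}
  | .or φ ψ => {φ, ψ}
  | .fus φ ψ => {φ, ψ}
  | .imp φ ψ => {φ, ψ}
  | .app _ args => Set.range args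
  | _ => ∅

/-- `F` is closed under immediate subformulas. -/
def SubClosed (F : Set (Formula L α)) : Prop :=
  ∀ φ ∈ F, φ.children ⊆ F

theorem box_mem_children {b : L.Conn} (hb : L.arity b = 1) (φ : Formula L α) :
    φ ∈ (φ.box b).children :=
  ⟨⟨0, by omega⟩, rfl⟩

theorem finite_children (φ : Formula L α) : φ.children.Finite := by
  cases φ <;> simp [children, Set.finite_range]

theorem exists_finite_subClosed (φ : Formula L α) :
    ∃ F : Set (Formula L α), F.Finite ∧ SubClosed F ∧ φ ∈ F := by
  have step (φ : Formula L α)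
      (h : ∀ χ ∈ φ.children, ∃ F : Set (Formula L α), F.Finite ∧ SubClosed F ∧ χ ∈ F) :
      ∃ F : Set (Formula L α), F.Finite ∧ SubClosed F ∧ φ ∈ F := by
    choose! G hfin hclosed hmem using h
    have hsub (χ) (hχ : χ ∈ φ.children) : G χ ⊆ insert φ (⋃ χ ∈ φ.children, G χ) :=
      (Set.subset_biUnion_of_mem hχ).trans (Set.subset_insert _ _)
    refine ⟨insert φ (⋃ χ ∈ φ.children, G χ),
      (φ.finite_children.biUnion hfin).insert φ, ?_, Set.mem_insert _ _⟩
    rintro θ (rfl | hθ)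
    · exact fun χ hχ => hsub χ hχ (hmem χ hχ)
    · obtain ⟨χ, hχ, hθ⟩ := Set.mem_iUnion₂.1 hθ
      exact (hclosed χ hχ θ hθ).trans (hsub χ hχ)
  induction φ with
  | app c args ih => exact step _ (by rintro _ ⟨i, rfl⟩; exact ih i)
  | _ => exact step _ (by simp_all [children])

theorem free_box {b : L.Conn} (hb : L.arity b = 1) {p : α} {φ : Formula L α} :
    (φ.box b).Free p ↔ φ.Free p := by
  have : Nonempty (Fin (L.arity b)) := ⟨⟨0, by omega⟩⟩
  simp [box, Free, vars]

@[simp] theorem free_top {p : α} : (top : Formula L α).Free p := by simp [Free, vars]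
@[simp] theorem free_bot {p : α} : (bot : Formula L α).Free p := by simp [Free, vars]
@[simp] theorem free_one {p : α} : (one : Formula L α).Free p := by simp [Free, vars]
@[simp] theorem free_zero {p : α} : (zero : Formula L α).Free p := by simp [Free, vars]
@[simp] theorem free_and {p : α} {φ ψ : Formula L α} :
    (and φ ψ).Free p ↔ φ.Free p ∧ ψ.Free p := by simp [Free, vars]
@[simp] theorem free_or {p : α} {φ ψ : Formula L α} :
    (or φ ψ).Free p ↔ φ.Free p ∧ ψ.Free p := by simp [Free, vars]
@[simp] theorem free_fus {p : α} {φ ψ : Formula L α} :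
    (fus φ ψ).Free p ↔ φ.Free p ∧ ψ.Free p := by simp [Free, vars]
@[simp] theorem free_imp {p : α} {φ ψ : Formula L α} :
    (imp φ ψ).Free p ↔ φ.Free p ∧ ψ.Free p := by simp [Free, vars]

end Formula

/-- The sum of the weights of the formulas in a multiset. -/
def antWeight (Γ : Multiset (Formula L α)) : ℕ := (Γ.map Formula.weight).sum

/-- The weight of a succedent. -/
def sucWeight : Option (Formula L α) → ℕ
  | none => 0
  | some φ => φ.weight

@[simp] theorem antWeight_zero : antWeight (0 : Multiset (Formula L α)) = 0 := rfl

@[simp] theorem antWeight_cons (φ : Formula L α) (Γ : Multiset (Formula L α)) :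
    antWeight (φ ::ₘ Γ) = φ.weight + antWeight Γ := by simp [antWeight]

@[simp] theorem antWeight_singleton (φ : Formula L α) : antWeight {φ} = φ.weight := by
  simp [antWeight]

@[simp] theorem antWeight_add (Γ Δ : Multiset (Formula L α)) :
    antWeight (Γ + Δ) = antWeight Γ + antWeight Δ := by simp [antWeight]

@[simp] theorem sucWeight_none : sucWeight (none : Option (Formula L α)) = 0 := rfl

@[simp] theorem sucWeight_some (φ : Formula L α) : sucWeight (some φ) = φ.weight := rfl

theorem card_le_antWeight (Γ : Multiset (Formula L α)) : Γ.card ≤ antWeight Γ := by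
  induction Γ using Multiset.induction with
  | empty => simp
  | cons φ Γ ih =>
    have := φ.weight_pos
    simp
    omega

theorem antWeight_pos {Γ : Multiset (Formula L α)} (h : Γ ≠ 0) : 0 < antWeight Γ :=
  (Multiset.card_pos.2 h).trans_le (card_le_antWeight Γ)

theorem antWeight_map_box {b : L.Conn} (hb : L.arity b = 1) (Γ : Multiset (Formula L α)) :
    antWeight (Γ.map (Formula.box b)) = antWeight Γ + Γ.card := by
  induction Γ using Multiset.induction with
  | empty => simp
  | cons φ Γ ih =>
    simp [Formula.weight_box hb, ih]
    omega

/-! ### One-premise rules: freeness, subformula property and decrease of weight -/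

section Rules

variable {W : Prop} {p : α} {a : Formula L α} {N : Multiset (Formula L α)}
  {Δ' Δ : Option (Formula L α)} {F : Set (Formula L α)}

theorem LeftRule.free (r : LeftRule W a N) (h : a.Free p) : ∀ γ ∈ N, γ.Free p := by
  cases r <;> simp_all

theorem LeftRule.subset (r : LeftRule W a N) (hF : Formula.SubClosed F) (h : a ∈ F) :
    ∀ γ ∈ N, γ ∈ F := by
  have := hF a h
  cases r <;> simp_all [Formula.children, Set.insert_subset_iff]

theorem LeftRule.weight_lt (r : LeftRule W a N) : antWeight N < a.weight := by
  cases r with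
  | weakening => simpa using a.weight_pos
  | fus => simp [Formula.weight]
  | _ => simp [Formula.weight]; try omega

theorem RightRule.free (r : RightRule W Δ' Δ) (h : ∀ δ ∈ Δ, δ.Free p) :
    ∀ δ ∈ Δ', δ.Free p := by
  cases r <;> simp_all

theorem RightRule.subset (r : RightRule W Δ' Δ) (hF : Formula.SubClosed F) (h : ∀ δ ∈ Δ, δ ∈ F) :
    ∀ δ ∈ Δ', δ ∈ F := by
  cases r with
  | or₁ φ ψ => have := hF _ (h _ rfl); simp_all [Formula.children, Set.insert_subset_iff]
  | or₂ φ ψ => have := hF _ (h _ rfl); simp_all [Formula.children, Set.insert_subset_iff]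
  | _ => simp

theorem RightRule.weight_lt (r : RightRule W Δ' Δ) : sucWeight Δ' < sucWeight Δ := by
  cases r with
  | weakening _ φ => simpa using φ.weight_pos
  | _ => simp [Formula.weight]; try omega

end Rules

/-! ### Interpolants of sequents and of multisets -/

/-- `A` is a `p`-pre-interpolant of the sequent `Γ ⇒ Δ`. -/
structure IsPre (W : Prop) (K : Set L.Conn) (D : Prop) (p : α) (Γ : Multiset (Formula L α))
    (Δ : Option (Formula L α)) (A : Formula L α) : Prop where
  free : A.Free p
  prf : Prf W K D (A ::ₘ Γ) Δ
  weakest : ∀ Ξ : Multiset (Formula L α), (∀ ξ ∈ Ξ, ξ.Free p) → Prf W K D (Ξ + Γ) Δ →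
    Prf W K D Ξ (some A)

/-- `E` is a `p`-post-interpolant of the multiset `Γ`. -/
structure IsPost (W : Prop) (K : Set L.Conn) (D : Prop) (p : α) (Γ : Multiset (Formula L α))
    (E : Formula L α) : Prop where
  free : E.Free p
  prf : Prf W K D Γ (some E)
  strongest : ∀ (Ξ : Multiset (Formula L α)) (Δ : Option (Formula L α)), (∀ ξ ∈ Ξ, ξ.Free p) →
    (∀ δ ∈ Δ, δ.Free p) → Prf W K D (Ξ + Γ) Δ → Prf W K D (E ::ₘ Ξ) Δ

/-- `U` contains interpolants of all sequents and multisets of formulas in `F` that are smaller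
than `n`. -/
structure Covers (W : Prop) (K : Set L.Conn) (D : Prop) (p : α) (F : Set (Formula L α)) (n : ℕ)
    (U : Set (Formula L α)) : Prop where
  pre : ∀ (Γ : Multiset (Formula L α)) (Δ : Option (Formula L α)), (∀ γ ∈ Γ, γ ∈ F) →
    (∀ δ ∈ Δ, δ ∈ F) → antWeight Γ + sucWeight Δ + 1 < n → ∃ u ∈ U, IsPre W K D p Γ Δ u
  post : ∀ Γ : Multiset (Formula L α), (∀ γ ∈ Γ, γ ∈ F) → antWeight Γ < n →
    ∃ u ∈ U, IsPost W K D p Γ u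

/-- The formulas among which the disjuncts of a pre-interpolant and the conjuncts of a
post-interpolant are found, given a set `U` of interpolants of smaller sequents. -/
inductive Candidate (K : Set L.Conn) (F U : Set (Formula L α)) : Formula L α → Prop
  | top : Candidate K F U .top
  | bot : Candidate K F U .bot
  | one : Candidate K F U .one
  | zero : Candidate K F U .zero
  | sub {φ : Formula L α} (h : φ ∈ F) : Candidate K F U φ
  | mem {u : Formula L α} (h : u ∈ U) : Candidate K F U u
  | and {u v : Formula L α} (hu : u ∈ U) (hv : v ∈ U) : Candidate K F U (.and u v)
  | or {u v : Formula L α} (hu : u ∈ U) (hv : v ∈ U) : Candidate K F U (.or u v)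
  | fus {u v : Formula L α} (hu : u ∈ U) (hv : v ∈ U) : Candidate K F U (.fus u v)
  | imp {u v : Formula L α} (hu : u ∈ U) (hv : v ∈ U) : Candidate K F U (.imp u v)
  | box {b : L.Conn} {u : Formula L α} (hb : b ∈ K) (hu : u ∈ U) : Candidate K F U (u.box b)

theorem finite_candidate {K : Set L.Conn} {F U : Set (Formula L α)} (hK : K.Finite)
    (hF : F.Finite) (hU : U.Finite) : {s | Candidate K F U s}.Finite := by
  refine ((((((((Set.toFinite {.top, .bot, .one, .zero}).union hF).union hU).union
    (hU.image2 Formula.and hU)).union (hU.image2 Formula.or hU)).union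
    (hU.image2 Formula.fus hU)).union (hU.image2 Formula.imp hU)).union
    (hK.image2 Formula.box hU)).subset ?_
  rintro s hs
  simp only [Set.mem_union, Set.mem_insert_iff, Set.mem_singleton_iff, Set.mem_image2]
  cases hs <;> grind

/-! ### Existence of interpolants by recursion on weight -/

section Interpolation

variable {W : Prop} {K : Set L.Conn} {D : Prop} {p : α} {F U T : Set (Formula L α)}
  {Γ Γ' : Multiset (Formula L α)} {Δ : Option (Formula L α)}

/-- The disjunction over `T` of the `p`-free `s` with `s, Γ ⇒ Δ` provable, where an empty
disjunction is `⊥`. That `A` is an upper bound is phrased as passing from `Ξ ⇒ s` to `Ξ ⇒ A`, which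
saves a cut. -/
theorem exists_join (hT : T.Finite) (p : α) (Γ : Multiset (Formula L α))
    (Δ : Option (Formula L α)) :
    ∃ A : Formula L α, A.Free p ∧ Prf W K D (A ::ₘ Γ) Δ ∧ ∀ s ∈ T, s.Free p →
      Prf W K D (s ::ₘ Γ) Δ → ∀ Ξ, Prf W K D Ξ (some s) → Prf W K D Ξ (some A) := by
  induction T, hT using Set.Finite.induction_on with
  | empty => exact ⟨.bot, by simp, .bot Γ Δ, by simp⟩
  | @insert a T _ _ ih =>
    obtain ⟨A, hA, hAΓ, ih⟩ := ih
    by_cases ha : a.Free p ∧ Prf W K D (a ::ₘ Γ) Δ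
    · refine ⟨.or a A, by simp [ha.1, hA], .orL ha.2 hAΓ, ?_⟩
      rintro s (rfl | hs) hfree hsΓ Ξ h
      · exact .right (.or₁ _ _) h
      · exact .right (.or₂ _ _) (ih s hs hfree hsΓ Ξ h)
    · refine ⟨A, hA, hAΓ, ?_⟩
      rintro s (rfl | hs) hfree hsΓ Ξ h
      · exact absurd ⟨hfree, hsΓ⟩ ha
      · exact ih s hs hfree hsΓ Ξ h

theorem exists_meet (hT : T.Finite) (p : α) (Γ : Multiset (Formula L α)) :
    ∃ E : Formula L α, E.Free p ∧ Prf W K D Γ (some E) ∧ ∀ s ∈ T, s.Free p →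
      Prf W K D Γ (some s) → ∀ Ξ Δ, Prf W K D (s ::ₘ Ξ) Δ → Prf W K D (E ::ₘ Ξ) Δ := by
  induction T, hT using Set.Finite.induction_on with
  | empty => exact ⟨.top, by simp, .top Γ, by simp⟩
  | @insert a T _ _ ih =>
    obtain ⟨E, hE, hEΓ, ih⟩ := ih
    by_cases ha : a.Free p ∧ Prf W K D Γ (some a)
    · refine ⟨.and a E, by simp [ha.1, hE], .andR ha.2 hEΓ, ?_⟩
      rintro s (rfl | hs) hfree hsΓ Ξ Δ h
      · exact .left (.and₁ _ _) h
      · exact .left (.and₂ _ _) (ih s hs hfree hsΓ Ξ Δ h)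
    · refine ⟨E, hE, hEΓ, ?_⟩
      rintro s (rfl | hs) hfree hsΓ Ξ Δ h
      · exact absurd ⟨hfree, hsΓ⟩ ha
      · exact ih s hs hfree hsΓ Ξ Δ h

theorem Prf.cast (h : Prf W K D Γ Δ) (e : Γ = Γ') : Prf W K D Γ' Δ := e ▸ h

/-- The size of a sequent has an extra `+ 1` over that of a multiset, so that the pre-interpolant of
`Γ ⇒` may use the post-interpolant of `Γ` itself. `Δ` stays fixed in the induction, and its
hypothesis is applied only to left rules acting on `Ξ`. -/
theorem exists_isPre (hK : ∀ b ∈ K, L.arity b = 1) (hKfin : K.Finite) (hF : Formula.SubClosed F)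
    (hFfin : F.Finite) (hUfin : U.Finite) (hΓ : ∀ γ ∈ Γ, γ ∈ F) (hΔ : ∀ δ ∈ Δ, δ ∈ F)
    (hU : Covers W K D p F (antWeight Γ + sucWeight Δ + 1) U) :
    ∃ A, IsPre W K D p Γ Δ A := by
  -- The empty sequent is treated by hand: the rule `D` can have it as both premise and conclusion
  -- parts, with no decrease in weight.
  by_cases h₀ : Γ = 0 ∧ Δ = none
  · obtain ⟨rfl, rfl⟩ := h₀
    exact ⟨.zero, by simp, .zero, fun Ξ _ h => .right .zero (by simpa using h)⟩
  obtain ⟨A, hA, hAΓ, join⟩ := exists_join (finite_candidate hKfin hFfin hUfin) p Γ Δ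
  refine ⟨A, hA, hAΓ, fun Ξ hΞ h => ?_⟩
  generalize hΓ' : Ξ + Γ = Γ' at h
  generalize hΔ' : Δ = Δ' at h
  induction h generalizing Ξ with
  | id φ =>
    subst hΔ'
    rcases cons_eq_add_cases (Γ := 0) hΓ'.symm with ⟨Ξ', rfl, h⟩ | ⟨Γ₁, rfl, h⟩
    · obtain ⟨rfl, rfl⟩ : Ξ' = 0 ∧ Γ = 0 := by simpa using h.symm
      exact join φ (.sub (hΔ _ rfl)) (hΞ _ (by simp)) (.id φ) _ (.id φ)
    · obtain ⟨rfl, rfl⟩ : Ξ = 0 ∧ Γ₁ = 0 := by simpa using h.symm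
      -- The sequent is itself an axiom and `Ξ` is empty, so the candidate must be derivable from
      -- nothing.
      exact join _ .one Formula.free_one (.left .one (by simpa using .id φ)) _ .one
  | top Γ' =>
    subst hΔ'
    exact join _ .top Formula.free_top (.top _) _ (.top _)
  | bot Γ' Δ' =>
    rcases cons_eq_add_cases hΓ'.symm with ⟨Ξ', rfl, rfl⟩ | ⟨Γ₁, rfl, rfl⟩
    · exact .bot _ _
    · exact join _ .top Formula.free_top (by rw [Multiset.cons_swap]; exact .bot _ _) _ (.top _)
  | one =>
    subst hΔ'
    obtain ⟨rfl, rfl⟩ : Ξ = 0 ∧ Γ = 0 := by simpa using hΓ'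
    exact join _ .one Formula.free_one (.left .one (by simpa using .one)) _ .one
  | zero =>
    subst hΔ'
    rcases cons_eq_add_cases (Γ := 0) hΓ'.symm with ⟨Ξ', rfl, h⟩ | ⟨Γ₁, rfl, h⟩
    · obtain ⟨rfl, rfl⟩ : Ξ' = 0 ∧ Γ = 0 := by simpa using h.symm
      simp at h₀
    · obtain ⟨rfl, rfl⟩ : Ξ = 0 ∧ Γ₁ = 0 := by simpa using h.symm
      exact join _ .one Formula.free_one (.left .one (by simpa using .zero)) _ .one
  | @left a N Γ' Δ' r h ih =>
    subst hΔ'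
    rcases cons_eq_add_cases hΓ'.symm with ⟨Ξ', rfl, rfl⟩ | ⟨Γ₁, rfl, rfl⟩
    · simp only [Multiset.forall_mem_cons] at hΞ
      refine .left r (ih (N + Ξ') ?_ (add_assoc _ _ _) rfl)
      simpa [or_imp, forall_and] using ⟨r.free hΞ.1, hΞ.2⟩
    · simp only [Multiset.forall_mem_cons] at hΓ
      have hr := r.weight_lt
      obtain ⟨u, hu, hu'⟩ := hU.pre (N + Γ₁) Δ
        (by simpa [or_imp, forall_and] using ⟨r.subset hF hΓ.1, hΓ.2⟩) hΔ (by simp; omega)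
      exact join u (.mem hu) hu'.free (.left_add r hu'.prf) Ξ
        (hu'.weakest Ξ hΞ (h.cast (add_left_comm _ _ _)))
  | @right Γ' Δ₁ Δ' r h ih =>
    subst hΔ' hΓ'
    have hr := r.weight_lt
    obtain ⟨u, hu, hu'⟩ := hU.pre Γ Δ₁ hΓ (r.subset hF hΔ) (by omega)
    exact join u (.mem hu) hu'.free (.right r hu'.prf) Ξ (hu'.weakest Ξ hΞ h)
  | @orL Γ' φ ψ Δ' h₁ h₂ ih₁ ih₂ =>
    subst hΔ'
    rcases cons_eq_add_cases hΓ'.symm with ⟨Ξ', rfl, rfl⟩ | ⟨Γ₁, rfl, rfl⟩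
    · simp only [Multiset.forall_mem_cons, Formula.free_or] at hΞ
      refine .orL (ih₁ (φ ::ₘ Ξ') ?_ (Multiset.cons_add _ _ _) rfl)
        (ih₂ (ψ ::ₘ Ξ') ?_ (Multiset.cons_add _ _ _) rfl) <;> simp_all
    · simp only [Multiset.forall_mem_cons] at hΓ
      have hφψ := hF _ hΓ.1
      simp only [Formula.children, Set.insert_subset_iff, Set.singleton_subset_iff] at hφψ
      obtain ⟨u, hu, hu'⟩ := hU.pre (φ ::ₘ Γ₁) Δ (by simp_all) hΔ
        (by simp [Formula.weight])
      obtain ⟨v, hv, hv'⟩ := hU.pre (ψ ::ₘ Γ₁) Δ (by simp_all) hΔ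
        (by simp [Formula.weight])
      refine join (.and u v) (.and hu hv) (by simp [hu'.free, hv'.free]) ?_ Ξ
        (.andR (hu'.weakest Ξ hΞ (h₁.cast (by simp))) (hv'.weakest Ξ hΞ (h₂.cast (by simp))))
      rw [Multiset.cons_swap]
      refine .orL ?_ ?_ <;> rw [Multiset.cons_swap]
      · exact .left (.and₁ u v) hu'.prf
      · exact .left (.and₂ u v) hv'.prf
  | @impL Γ' Θ φ ψ Δ' h₁ h₂ ih₁ ih₂ =>
    subst hΔ'
    rcases cons_eq_add_cases hΓ'.symm with ⟨Ξ', rfl, h⟩ | ⟨Γ₁, rfl, h⟩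
    · simp only [Multiset.forall_mem_cons, Formula.free_imp] at hΞ
      obtain ⟨Ξ₁, Ξ₂, Γ₁, Γ₂, rfl, rfl, rfl, rfl⟩ := add_eq_add_refine h
      simp only [Multiset.mem_add, or_imp, forall_and] at hΞ hΓ
      -- If `Γ₁` is empty, `Γ₂ ⇒ Δ` is the whole sequent and not smaller; the right premise then
      -- falls under the induction hypothesis.
      by_cases hΓ₁ : Γ₁ = 0
      · subst hΓ₁
        refine .impL (by simpa using h₁) (ih₂ (ψ ::ₘ Ξ₂) ?_ (by simp) rfl)
        simp_all
      · have hpos := antWeight_pos hΓ₁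
        obtain ⟨u, hu, hu'⟩ := hU.post Γ₁ hΓ.1 (by simp; omega)
        obtain ⟨v, hv, hv'⟩ := hU.pre Γ₂ Δ hΓ.2 hΔ (by simp; omega)
        -- Interpolating the premises gives `u, Ξ₁ ⇒ φ` and `ψ, Ξ₂ ⇒ v`; the left rule for the
        -- implication in `Ξ` joins them to a proof of `u → v`.
        refine join (.imp u v) (.imp hu hv) (by simp [hu'.free, hv'.free]) ?_ _ (.impR ?_)
        · exact .impL hu'.prf hv'.prf
        · refine (Prf.impL (hu'.strongest Ξ₁ (some φ) hΞ.2.1 (by simp [hΞ.1]) h₁)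
            (hv'.weakest (ψ ::ₘ Ξ₂) (by simp_all) (h₂.cast (by simp)))).cast ?_
          rw [Multiset.cons_add, Multiset.cons_swap]
    · obtain ⟨Ξ₁, Ξ₂, Γ₁, Γ₂, rfl, rfl, rfl, rfl⟩ := add_eq_add_refine h
      simp only [Multiset.forall_mem_cons, Multiset.mem_add, or_imp, forall_and] at hΞ hΓ
      have hφψ := hF _ hΓ.1
      simp only [Formula.children, Set.insert_subset_iff, Set.singleton_subset_iff] at hφψ
      obtain ⟨u, hu, hu'⟩ := hU.pre Γ₁ (some φ) hΓ.2.1 (by simp_all)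
        (by simp [Formula.weight]; omega)
      obtain ⟨v, hv, hv'⟩ := hU.pre (ψ ::ₘ Γ₂) Δ (by simp_all) hΔ
        (by simp [Formula.weight]; omega)
      refine join (.fus u v) (.fus hu hv) (by simp [hu'.free, hv'.free]) (.left (.fus u v) ?_) _
        (.fusR (hu'.weakest Ξ₁ hΞ.1 h₁) (hv'.weakest Ξ₂ hΞ.2 (h₂.cast (by simp))))
      refine (Prf.impL hu'.prf (Θ := v ::ₘ Γ₂) (hv'.prf.cast (Multiset.cons_swap _ _ _))).cast ?_
      simp only [← Multiset.singleton_add, Multiset.insert_eq_cons]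
      abel
  | @andR Γ' φ ψ h₁ h₂ ih₁ ih₂ =>
    subst hΔ' hΓ'
    have hφψ := hF _ (hΔ _ rfl)
    simp only [Formula.children, Set.insert_subset_iff, Set.singleton_subset_iff] at hφψ
    obtain ⟨u, hu, hu'⟩ := hU.pre Γ (some φ) hΓ (by simp_all) (by simp [Formula.weight])
    obtain ⟨v, hv, hv'⟩ := hU.pre Γ (some ψ) hΓ (by simp_all) (by simp [Formula.weight])
    exact join (.and u v) (.and hu hv) (by simp [hu'.free, hv'.free])
      (.andR (.left (.and₁ u v) hu'.prf) (.left (.and₂ u v) hv'.prf)) Ξ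
      (.andR (hu'.weakest Ξ hΞ h₁) (hv'.weakest Ξ hΞ h₂))
  | @fusR Γ' Θ φ ψ h₁ h₂ ih₁ ih₂ =>
    subst hΔ'
    have hφψ := hF _ (hΔ _ rfl)
    simp only [Formula.children, Set.insert_subset_iff, Set.singleton_subset_iff] at hφψ
    obtain ⟨Ξ₁, Ξ₂, Γ₁, Γ₂, rfl, rfl, rfl, rfl⟩ := add_eq_add_refine hΓ'.symm
    simp only [Multiset.mem_add, or_imp, forall_and] at hΞ hΓ
    obtain ⟨u, hu, hu'⟩ := hU.pre Γ₁ (some φ) hΓ.1 (by simp_all)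
      (by simp [Formula.weight]; omega)
    obtain ⟨v, hv, hv'⟩ := hU.pre Γ₂ (some ψ) hΓ.2 (by simp_all)
      (by simp [Formula.weight]; omega)
    refine join (.fus u v) (.fus hu hv) (by simp [hu'.free, hv'.free]) (.left (.fus u v) ?_) _
      (.fusR (hu'.weakest Ξ₁ hΞ.1 h₁) (hv'.weakest Ξ₂ hΞ.2 h₂))
    refine (Prf.fusR hu'.prf hv'.prf).cast ?_
    simp only [← Multiset.singleton_add, Multiset.insert_eq_cons]
    abel
  | @impR Γ' φ ψ h ih =>
    subst hΔ' hΓ'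
    have hφψ := hF _ (hΔ _ rfl)
    simp only [Formula.children, Set.insert_subset_iff, Set.singleton_subset_iff] at hφψ
    obtain ⟨u, hu, hu'⟩ := hU.pre (φ ::ₘ Γ) (some ψ) (by simp_all) (by simp_all)
      (by simp [Formula.weight]; omega)
    exact join u (.mem hu) hu'.free (.impR (hu'.prf.cast (Multiset.cons_swap _ _ _))) Ξ
      (hu'.weakest Ξ hΞ (h.cast (by simp)))
  | @modal Γ' Δ₁ b hb hD h ih =>
    subst hΔ'
    obtain ⟨Ξ', Γ₁, rfl, rfl, rfl⟩ := map_eq_add_refine hΓ'.symm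
    have hb₁ := hK b hb
    obtain ⟨u, hu, hu'⟩ := hU.pre Γ₁ Δ₁
      (fun γ hγ => hF _ (hΓ _ (Multiset.mem_map_of_mem _ hγ)) (Formula.box_mem_children hb₁ γ))
      (fun δ hδ => hF _ (hΔ _ (Option.mem_map_of_mem _ hδ)) (Formula.box_mem_children hb₁ δ))
      (by
        rw [antWeight_map_box hb₁]
        cases Δ₁ with
        | none => have := Multiset.card_pos (s := Γ₁); simp_all; omega
        | some φ => simp [Formula.weight_box hb₁]; omega)
    -- The proof of `□Ξ' ⇒ □u` is an instance of `K` even if the given step is one of `D`; `D` is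
    -- needed only for `□u, □Γ₁ ⇒`.
    refine join (u.box b) (.box hb hu) ((Formula.free_box hb₁).2 hu'.free) ?_ _
      (Prf.modal (Δ := some u) hb (by simp) (hu'.weakest Ξ' ?_ h))
    · simpa using Prf.modal hb hD hu'.prf
    · exact fun ξ hξ => (Formula.free_box hb₁).1 (hΞ _ (Multiset.mem_map_of_mem _ hξ))

/-- Here `Δ` is `p`-free and varies in the induction, so one-premise right rules and those for `∧`
and `→` pass through the induction hypothesis. The right rule for `*` may split `Γ` and then needs a
fusion of post-interpolants. -/
theorem exists_isPost (hK : ∀ b ∈ K, L.arity b = 1) (hKfin : K.Finite) (hF : Formula.SubClosed F)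
    (hFfin : F.Finite) (hUfin : U.Finite) (hΓ : ∀ γ ∈ Γ, γ ∈ F)
    (hU : Covers W K D p F (antWeight Γ) U) : ∃ E, IsPost W K D p Γ E := by
  by_cases h₀ : Γ = 0
  · subst h₀
    exact ⟨.one, by simp, .one, fun Ξ _ _ _ h => .left .one (by simpa using h)⟩
  obtain ⟨E, hE, hEΓ, meet⟩ := exists_meet (finite_candidate hKfin hFfin hUfin) p Γ
  refine ⟨E, hE, hEΓ, fun Ξ Δ hΞ hΔ h => ?_⟩
  generalize hΓ' : Ξ + Γ = Γ' at h
  induction h generalizing Ξ with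
  | id φ =>
    rcases cons_eq_add_cases (Γ := 0) hΓ'.symm with ⟨Ξ', rfl, h⟩ | ⟨Γ₁, rfl, h⟩
    · exact absurd (by simpa using h.symm : Ξ' = 0 ∧ Γ = 0).2 h₀
    · obtain ⟨rfl, rfl⟩ : Ξ = 0 ∧ Γ₁ = 0 := by simpa using h.symm
      exact meet φ (.sub (hΓ _ (by simp))) (hΔ _ rfl) (.id φ) _ _ (.id φ)
  | top Γ' => exact .top _
  | bot Γ' Δ =>
    rcases cons_eq_add_cases hΓ'.symm with ⟨Ξ', rfl, rfl⟩ | ⟨Γ₁, rfl, rfl⟩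
    · rw [Multiset.cons_swap]
      exact .bot _ _
    · exact meet _ .bot Formula.free_bot (.bot _ _) _ _ (.bot _ _)
  | one => simp_all
  | zero =>
    rcases cons_eq_add_cases (Γ := 0) hΓ'.symm with ⟨Ξ', rfl, h⟩ | ⟨Γ₁, rfl, h⟩
    · exact absurd (by simpa using h.symm : Ξ' = 0 ∧ Γ = 0).2 h₀
    · obtain ⟨rfl, rfl⟩ : Ξ = 0 ∧ Γ₁ = 0 := by simpa using h.symm
      exact meet _ .zero Formula.free_zero (.id _) _ _ .zero
  | @left a N Γ' Δ r h ih =>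
    rcases cons_eq_add_cases hΓ'.symm with ⟨Ξ', rfl, rfl⟩ | ⟨Γ₁, rfl, rfl⟩
    · simp only [Multiset.forall_mem_cons] at hΞ
      refine .left_add r (ih (N + Ξ') ?_ hΔ (add_assoc _ _ _))
      simpa [or_imp, forall_and] using ⟨r.free hΞ.1, hΞ.2⟩
    · simp only [Multiset.forall_mem_cons] at hΓ
      have hr := r.weight_lt
      obtain ⟨u, hu, hu'⟩ := hU.post (N + Γ₁)
        (by simpa [or_imp, forall_and] using ⟨r.subset hF hΓ.1, hΓ.2⟩) (by simp; omega)
      exact meet u (.mem hu) hu'.free (.left r hu'.prf) Ξ Δ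
        (hu'.strongest Ξ Δ hΞ hΔ (h.cast (add_left_comm _ _ _)))
  | right r h ih => exact .right r (ih Ξ hΞ (r.free hΔ) hΓ')
  | @orL Γ' φ ψ Δ h₁ h₂ ih₁ ih₂ =>
    rcases cons_eq_add_cases hΓ'.symm with ⟨Ξ', rfl, rfl⟩ | ⟨Γ₁, rfl, rfl⟩
    · simp only [Multiset.forall_mem_cons, Formula.free_or] at hΞ
      rw [Multiset.cons_swap]
      refine .orL ?_ ?_ <;> rw [Multiset.cons_swap]
      · exact ih₁ (φ ::ₘ Ξ') (by simp_all) hΔ (Multiset.cons_add _ _ _)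
      · exact ih₂ (ψ ::ₘ Ξ') (by simp_all) hΔ (Multiset.cons_add _ _ _)
    · simp only [Multiset.forall_mem_cons] at hΓ
      have hφψ := hF _ hΓ.1
      simp only [Formula.children, Set.insert_subset_iff, Set.singleton_subset_iff] at hφψ
      obtain ⟨u, hu, hu'⟩ := hU.post (φ ::ₘ Γ₁) (by simp_all) (by simp [Formula.weight])
      obtain ⟨v, hv, hv'⟩ := hU.post (ψ ::ₘ Γ₁) (by simp_all) (by simp [Formula.weight])
      exact meet (.or u v) (.or hu hv) (by simp [hu'.free, hv'.free])
        (.orL (.right (.or₁ u v) hu'.prf) (.right (.or₂ u v) hv'.prf)) Ξ Δ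
        (.orL (hu'.strongest Ξ Δ hΞ hΔ (h₁.cast (by simp)))
          (hv'.strongest Ξ Δ hΞ hΔ (h₂.cast (by simp))))
  | @impL Γ' Θ φ ψ Δ h₁ h₂ ih₁ ih₂ =>
    rcases cons_eq_add_cases hΓ'.symm with ⟨Ξ', rfl, h⟩ | ⟨Γ₁, rfl, h⟩
    · simp only [Multiset.forall_mem_cons, Formula.free_imp] at hΞ
      obtain ⟨Ξ₁, Ξ₂, Γ₁, Γ₂, rfl, rfl, rfl, rfl⟩ := add_eq_add_refine h
      simp only [Multiset.mem_add, or_imp, forall_and] at hΞ hΓ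
      rw [Multiset.cons_swap]
      -- If one half of `Γ` is empty, the other is all of `Γ` and not smaller; `E` then goes to its
      -- premise by the induction hypothesis.
      by_cases hΓ₁ : Γ₁ = 0
      · subst hΓ₁
        have := ih₂ (ψ ::ₘ Ξ₂) (by simp_all) hΔ (by simp)
        exact (Prf.impL h₁ (this.cast (Multiset.cons_swap _ _ _))).cast (by simp)
      by_cases hΓ₂ : Γ₂ = 0
      · subst hΓ₂
        have := ih₁ Ξ₁ hΞ.2.1 (by simp [hΞ.1]) (by simp)
        exact (Prf.impL this h₂).cast (by simp)
      have hpos₁ := antWeight_pos hΓ₁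
      have hpos₂ := antWeight_pos hΓ₂
      obtain ⟨u, hu, hu'⟩ := hU.post Γ₁ hΓ.1 (by simp; omega)
      obtain ⟨v, hv, hv'⟩ := hU.post Γ₂ hΓ.2 (by simp; omega)
      rw [Multiset.cons_swap]
      refine meet (.fus u v) (.fus hu hv) (by simp [hu'.free, hv'.free])
        (.fusR hu'.prf hv'.prf) _ _ (.left (.fus u v) ?_)
      have h₃ := hu'.strongest Ξ₁ (some φ) hΞ.2.1 (by simp [hΞ.1]) h₁
      have h₄ := hv'.strongest (ψ ::ₘ Ξ₂) Δ (by simp_all) hΔ (h₂.cast (by simp))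
      refine (Prf.impL h₃ (h₄.cast (Multiset.cons_swap _ _ _))).cast ?_
      simp only [← Multiset.singleton_add, Multiset.insert_eq_cons]
      abel
    · obtain ⟨Ξ₁, Ξ₂, Γ₁, Γ₂, rfl, rfl, rfl, rfl⟩ := add_eq_add_refine h
      simp only [Multiset.forall_mem_cons, Multiset.mem_add, or_imp, forall_and] at hΞ hΓ
      have hφψ := hF _ hΓ.1
      simp only [Formula.children, Set.insert_subset_iff, Set.singleton_subset_iff] at hφψ
      -- The second unit in the weight of an implication absorbs the extra `+ 1` in the size of `Γ₁
      -- ⇒ φ`.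
      obtain ⟨u, hu, hu'⟩ := hU.pre Γ₁ (some φ) hΓ.2.1 (by simp_all)
        (by simp [Formula.weight]; omega)
      obtain ⟨v, hv, hv'⟩ := hU.post (ψ ::ₘ Γ₂) (by simp_all) (by simp [Formula.weight]; omega)
      refine meet (.imp u v) (.imp hu hv) (by simp [hu'.free, hv'.free]) (.impR ?_) _ _
        (.impL (hu'.weakest Ξ₁ hΞ.1 h₁) (hv'.strongest Ξ₂ Δ hΞ.2 hΔ (h₂.cast (by simp))))
      refine (Prf.impL hu'.prf hv'.prf).cast ?_
      rw [Multiset.cons_add, Multiset.cons_swap]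
  | andR h₁ h₂ ih₁ ih₂ =>
    exact .andR (ih₁ Ξ hΞ (by simp_all) hΓ') (ih₂ Ξ hΞ (by simp_all) hΓ')
  | @fusR Γ' Θ φ ψ h₁ h₂ ih₁ ih₂ =>
    simp only [Option.mem_some_iff, forall_eq', Formula.free_fus] at hΔ
    obtain ⟨Ξ₁, Ξ₂, Γ₁, Γ₂, rfl, rfl, rfl, rfl⟩ := add_eq_add_refine hΓ'.symm
    simp only [Multiset.mem_add, or_imp, forall_and] at hΞ hΓ
    by_cases hΓ₁ : Γ₁ = 0
    · subst hΓ₁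
      have := ih₂ Ξ₂ hΞ.2 (by simp [hΔ.2]) (by simp)
      exact (Prf.fusR h₁ this).cast (by simp)
    by_cases hΓ₂ : Γ₂ = 0
    · subst hΓ₂
      have := ih₁ Ξ₁ hΞ.1 (by simp [hΔ.1]) (by simp)
      exact (Prf.fusR this h₂).cast (by simp)
    have hpos₁ := antWeight_pos hΓ₁
    have hpos₂ := antWeight_pos hΓ₂
    obtain ⟨u, hu, hu'⟩ := hU.post Γ₁ hΓ.1 (by simp; omega)
    obtain ⟨v, hv, hv'⟩ := hU.post Γ₂ hΓ.2 (by simp; omega)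
    refine meet (.fus u v) (.fus hu hv) (by simp [hu'.free, hv'.free])
      (.fusR hu'.prf hv'.prf) _ _ (.left (.fus u v) ?_)
    refine (Prf.fusR (hu'.strongest Ξ₁ (some φ) hΞ.1 (by simp [hΔ.1]) h₁)
      (hv'.strongest Ξ₂ (some ψ) hΞ.2 (by simp [hΔ.2]) h₂)).cast ?_
    simp only [← Multiset.singleton_add, Multiset.insert_eq_cons]
    abel
  | @impR Γ' φ ψ h ih =>
    subst hΓ'
    simp only [Option.mem_some_iff, forall_eq', Formula.free_imp] at hΔ
    refine .impR ?_
    rw [Multiset.cons_swap]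
    exact ih (φ ::ₘ Ξ) (by simp_all) (by simp [hΔ.2]) (by simp)
  | @modal Γ' Δ b hb hD h ih =>
    obtain ⟨Ξ', Γ₁, rfl, rfl, rfl⟩ := map_eq_add_refine hΓ'.symm
    have hb₁ := hK b hb
    obtain ⟨u, hu, hu'⟩ := hU.post Γ₁
      (fun γ hγ => hF _ (hΓ _ (Multiset.mem_map_of_mem _ hγ)) (Formula.box_mem_children hb₁ γ))
      (by
        have := Multiset.card_pos (s := Γ₁)
        rw [antWeight_map_box hb₁]
        simp_all)
    refine meet (u.box b) (.box hb hu) ((Formula.free_box hb₁).2 hu'.free)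
      (Prf.modal (Δ := some u) hb (by simp) hu'.prf) _ _ ?_
    have := hu'.strongest Ξ' Δ
      (fun ξ hξ => (Formula.free_box hb₁).1 (hΞ _ (Multiset.mem_map_of_mem _ hξ)))
      (fun δ hδ => (Formula.free_box hb₁).1 (hΔ _ (Option.mem_map_of_mem _ hδ))) h
    simpa using Prf.modal hb hD this

/-- Over a finite `F` there are finitely many sequents of each size, since weight bounds
cardinality. Adding one interpolant for each sequent and multiset of size `n` therefore keeps `U`
finite. -/
theorem exists_covers (hK : ∀ b ∈ K, L.arity b = 1) (hKfin : K.Finite) (hF : Formula.SubClosed F)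
    (hFfin : F.Finite) (p : α) (n : ℕ) : ∃ U, U.Finite ∧ Covers W K D p F n U := by
  induction n with
  | zero => exact ⟨∅, Set.finite_empty, by simp, by simp⟩
  | succ n ih =>
    obtain ⟨U, hUfin, hU⟩ := ih
    -- The conditions stand inside the existential, with `⊤` as a dummy value, so that choice yields
    -- total functions whose images are finite.
    have hpre (Γ : Multiset (Formula L α)) (Δ : Option (Formula L α)) :
        ∃ A, (∀ γ ∈ Γ, γ ∈ F) → (∀ δ ∈ Δ, δ ∈ F) → antWeight Γ + sucWeight Δ + 1 = n →
          IsPre W K D p Γ Δ A := by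
      by_cases h : (∀ γ ∈ Γ, γ ∈ F) ∧ (∀ δ ∈ Δ, δ ∈ F) ∧ antWeight Γ + sucWeight Δ + 1 = n
      · obtain ⟨hΓ, hΔ, rfl⟩ := h
        obtain ⟨A, hA⟩ := exists_isPre hK hKfin hF hFfin hUfin hΓ hΔ hU
        exact ⟨A, fun _ _ _ => hA⟩
      · exact ⟨.top, fun h₁ h₂ h₃ => absurd ⟨h₁, h₂, h₃⟩ h⟩
    have hpost (Γ : Multiset (Formula L α)) :
        ∃ E, (∀ γ ∈ Γ, γ ∈ F) → antWeight Γ = n → IsPost W K D p Γ E := by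
      by_cases h : (∀ γ ∈ Γ, γ ∈ F) ∧ antWeight Γ = n
      · obtain ⟨hΓ, rfl⟩ := h
        obtain ⟨E, hE⟩ := exists_isPost hK hKfin hF hFfin hUfin hΓ hU
        exact ⟨E, fun _ _ => hE⟩
      · exact ⟨.top, fun h₁ h₂ => absurd ⟨h₁, h₂⟩ h⟩
    choose A hA using hpre
    choose E hE using hpost
    have hant := finite_multisets_over hFfin n
    have hsuc : {Δ : Option (Formula L α) | ∀ δ ∈ Δ, δ ∈ F}.Finite := by
      refine ((hFfin.image some).insert none).subset fun Δ hΔ => ?_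
      cases Δ <;> simp_all
    refine ⟨U ∪ (Set.image2 A _ _ ∪ E '' _),
      hUfin.union ((hant.image2 A hsuc).union (hant.image E)), fun Γ Δ hΓ hΔ h => ?_,
      fun Γ hΓ h => ?_⟩
    · rcases Nat.lt_succ_iff_lt_or_eq.1 h with h | h
      · obtain ⟨u, hu, hu'⟩ := hU.pre Γ Δ hΓ hΔ h
        exact ⟨u, .inl hu, hu'⟩
      · have := card_le_antWeight Γ
        exact ⟨A Γ Δ, .inr (.inl ⟨Γ, ⟨hΓ, by omega⟩, Δ, hΔ, rfl⟩), hA Γ Δ hΓ hΔ h⟩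
    · rcases Nat.lt_succ_iff_lt_or_eq.1 h with h | h
      · obtain ⟨u, hu, hu'⟩ := hU.post Γ hΓ h
        exact ⟨u, .inl hu, hu'⟩
      · have := card_le_antWeight Γ
        exact ⟨E Γ, .inr (.inr ⟨Γ, ⟨hΓ, by omega⟩, rfl⟩), hE Γ hΓ h⟩

theorem Calculus.HasRules.hasUniformInterpolation {R : Calculus L α} (hR : R.HasRules W K D)
    (hK : ∀ b ∈ K, L.arity b = 1) (hKfin : K.Finite) : HasUniformInterpolation R.logic := by
  intro φ p
  have logic_iff (χ θ : Formula L α) : .imp χ θ ∈ R.logic ↔ Prf W K D {χ} (some θ) :=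
    Iff.trans ⟨Derivable.prf hR, Prf.derivable hR⟩ prf_imp_iff
  obtain ⟨F, hFfin, hF, hφ⟩ := φ.exists_finite_subClosed
  -- The sequent `⇒ φ` has size `φ.weight + 1`, hence the bound `φ.weight + 2`.
  obtain ⟨U, -, hU⟩ := exists_covers (W := W) (D := D) hK hKfin hF hFfin p (φ.weight + 2)
  obtain ⟨A, -, hA⟩ := hU.pre 0 (some φ) (by simp) (by simpa) (by simp)
  obtain ⟨E, -, hE⟩ := hU.post {φ} (by simpa) (by simp)
  simp only [logic_iff]
  exact ⟨A, E, hA.free, hE.free, hA.prf,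
    fun ψ hψ h => hA.weakest {ψ} (by simpa) (by simpa using h), hE.prf,
    fun ψ hψ h => hE.strongest 0 (some ψ) (by simp) (by simpa) (by simpa using h)⟩

end Interpolation

end Substructural

theorem mainTheorem9 (L : Substructural.Language) (α : Type*) :
    Substructural.HasUniformInterpolation
      (Substructural.Calculus.logic (Substructural.FLe : Substructural.Calculus L α)) ∧
    Substructural.HasUniformInterpolation
      (Substructural.Calculus.logic (Substructural.FLew : Substructural.Calculus L α)) ∧
    ∀ b : L.Conn, L.arity b = 1 →
      Substructural.HasUniformInterpolation (Substructural.Calculus.logic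
        (Substructural.Calculus.withK (Substructural.FLe : Substructural.Calculus L α) b)) ∧
      Substructural.HasUniformInterpolation (Substructural.Calculus.logic
        (Substructural.Calculus.withKD (Substructural.FLe : Substructural.Calculus L α) b)) ∧
      Substructural.HasUniformInterpolation (Substructural.Calculus.logic
        (Substructural.Calculus.withK (Substructural.FLew : Substructural.Calculus L α) b)) ∧
      Substructural.HasUniformInterpolation (Substructural.Calculus.logic
        (Substructural.Calculus.withKD (Substructural.FLew : Substructural.Calculus L α) b)) := by
  open Substructural Calculus in
  refine ⟨HasRules.hasUniformInterpolation (W := False) (K := ∅) (D := False) ?_ (by simp)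
      Set.finite_empty,
    HasRules.hasUniformInterpolation (W := True) (K := ∅) (D := False) ?_ (by simp)
      Set.finite_empty, fun b hb =>
    ⟨HasRules.hasUniformInterpolation (W := False) (K := {b}) (D := False) ?_ (by simpa)
      (Set.finite_singleton b),
    HasRules.hasUniformInterpolation (W := False) (K := {b}) (D := True) ?_ (by simpa)
      (Set.finite_singleton b),
    HasRules.hasUniformInterpolation (W := True) (K := {b}) (D := False) ?_ (by simpa)
      (Set.finite_singleton b),
    HasRules.hasUniformInterpolation (W := True) (K := {b}) (D := True) ?_ (by simpa)
      (Set.finite_singleton b)⟩⟩ <;>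
  intro ps S <;> simp [FLew, withK, withKD, or_assoc]
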